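/- Let $n\ge 1$ be an integer and $p\in\{0,1,2,\dots\}\cup\{+\infty\}$. Let $D^n=\{z\in\mathbb C^n:|z_i|<1\text{ for all }i\}$ and $\mathbb T^n=\{z\in\mathbb C^n:|z_i|=1\text{ for all }i\}$. Let $A^p(D^n)$ be the space of holomorphic functions $f$ on $D^n$ whose partial derivatives $\partial^\alpha f/\partial z^\alpha$ extend continuously to $\overline{D^n}$ for all multi-indices $\alpha$ with $|\alpha|\le p$, with the topology given by the seminorms $\sup_{z\in D^n}|\partial^\alpha f/\partial z^\alpha(z)|$, $|\alpha|\le p$; each $f\in A^p(D^n)$ is identified with its continuous extension to $\overline{D^n}$. Call $f$ real analytic at $(e^{i\theta_1},\dots,e^{i\theta_n})\in\mathbb T^n$ if there are $\delta>0$ and a power series $\sum_{k\in\mathbb N^n}a_k(t_1-\theta_1)^{k_1}\cdots(t_n-\theta_n)^{k_n}$ with complex coefficients that converges absolutely and uniformly on $\prod_{i=1}^n[\theta_i-\delta,\theta_i+\delta]$, with sum $f(e^{it_1},\dots,e^{it_n})$ there. Then: 1. for every $\zeta\in\mathbb T^n$, the set of $f\in A^p(D^n)$ that are not real analytic at $\zeta$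 is a dense $G_\delta$ subset of $A^p(D^n)$; 2. the set of $f\in A^p(D^n)$ that are not real analytic at any point of $\mathbb T^n$ is a dense $G_\delta$ subset of $A^p(D^n)$. -/

import Mathlib

open Set Topology

noncomputable section

/-- The open unit polydisc `Dⁿ` in `ℂⁿ`. -/
def polydisc (n : ℕ) : Set (Fin n → ℂ) := {z | ∀ i, ‖z i‖ < 1}

/-- The closed unit polydisc, the closure of `Dⁿ` in `ℂⁿ`. -/
def closedPolydisc (n : ℕ) : Set (Fin n → ℂ) := {z | ∀ i, ‖z i‖ ≤ 1}

/-- The mixed partial derivative `∂^α f = ∂^|α| f / ∂z₁^α₁ ⋯ ∂zₙ^αₙ` of a function on `ℂⁿ`, as an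
iteration of the first-order complex partial derivatives `∂/∂zᵢ`. -/
def mixedPartial {n : ℕ} (α : Fin n → ℕ) (f : (Fin n → ℂ) → ℂ) : (Fin n → ℂ) → ℂ :=
  (List.finRange n).foldr
    (fun i g => (fun (h : (Fin n → ℂ) → ℂ) z => lineDeriv ℂ h z (Pi.single i 1))^[α i] g) f

/-- A function on the closed polydisc, continued by zero to all of `ℂⁿ`. Only its values and
derivatives on the open polydisc are used below, where they do not depend on the continuation. -/
def zeroExtend {n : ℕ} (f : closedPolydisc n → ℂ) : (Fin n → ℂ) → ℂ :=
  Function.extend Subtype.val f 0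

/-- The space `A^p(Dⁿ)`, `p ∈ {0, 1, …} ∪ {∞}`: the functions holomorphic on `Dⁿ` all of whose
partial derivatives of order at most `p` extend continuously to the closed polydisc. A function
in `A^p(Dⁿ)` is identified with its continuous extension to the closed polydisc (the case
`α = 0` of the condition). -/
structure PolydiscAlgebra (n : ℕ) (p : ℕ∞) where
  /-- the function, on the closed polydisc -/
  toContinuousMap : C(closedPolydisc n, ℂ)
  holomorphic : DifferentiableOn ℂ (zeroExtend toContinuousMap) (polydisc n)
  partials_extend : ∀ α : Fin n → ℕ, ((∑ i, α i : ℕ) : ℕ∞) ≤ p →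
    ∃ g : (Fin n → ℂ) → ℂ, ContinuousOn g (closedPolydisc n) ∧
      EqOn (mixedPartial α (zeroExtend toContinuousMap)) g (polydisc n)

namespace PolydiscAlgebra

variable {n : ℕ} {p : ℕ∞}

/-- The family of the partial derivatives `∂^α f`, `|α| ≤ p`, as functions on `Dⁿ`; the target
carries the (product of the) uniformity of uniform convergence on `Dⁿ`. -/
def partials (f : PolydiscAlgebra n p) :
    (α : {α : Fin n → ℕ // ((∑ i, α i : ℕ) : ℕ∞) ≤ p}) → UniformFun (polydisc n) ℂ :=
  fun α => UniformFun.ofFun fun z => mixedPartial α.1 (zeroExtend f.toContinuousMap) z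

/-- The uniform structure of the space `A^p(Dⁿ)` with the seminorms `sup_{z ∈ Dⁿ} |∂^α f(z)|`,
`|α| ≤ p`: uniform convergence on `Dⁿ` of every partial derivative of order at most `p`. The
topology of `A^p(Dⁿ)` is the one underlying it. -/
instance : UniformSpace (PolydiscAlgebra n p) := UniformSpace.comap partials inferInstance

/-- The restriction of a function in `A^p(Dⁿ)` to the distinguished boundary `𝕋ⁿ`. -/
def restrictTorus (f : PolydiscAlgebra n p) (ζ : Fin n → Circle) : ℂ :=
  f.toContinuousMap ⟨fun i => (ζ i : ℂ), fun i => (Circle.norm_coe (ζ i)).le⟩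

end PolydiscAlgebra

/-- `f : 𝕋ⁿ → ℂ` is real analytic at `ζ = (e^{iθ₁}, …, e^{iθₙ})`: on some box
`∏ [θᵢ - δ, θᵢ + δ]`, `δ > 0`, the function `f(e^{it₁}, …, e^{itₙ})` is the sum of a power series
`∑ aₖ (t₁ - θ₁)^k₁ ⋯ (tₙ - θₙ)^kₙ` that converges absolutely and uniformly there. -/
def TorusRealAnalyticAt {n : ℕ} (f : (Fin n → Circle) → ℂ) (ζ : Fin n → Circle) : Prop :=
  ∃ θ : Fin n → ℝ, (∀ i, Circle.exp (θ i) = ζ i) ∧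
    ∃ (a : (Fin n → ℕ) → ℂ) (δ : ℝ), 0 < δ ∧
      (∀ t ∈ Icc (fun i => θ i - δ) (fun i => θ i + δ),
        Summable fun k : Fin n → ℕ => ‖a k * ∏ i, ((t i - θ i : ℝ) : ℂ) ^ k i‖) ∧
      HasSumUniformlyOn
        (fun (k : Fin n → ℕ) (t : Fin n → ℝ) => a k * ∏ i, ((t i - θ i : ℝ) : ℂ) ^ k i)
        (fun t => f fun i => Circle.exp (t i))
        (Icc (fun i => θ i - δ) (fun i => θ i + δ))

end

/-! Both assertions reduce to two facts: for closed `K ⊆ 𝕋ⁿ` the functions analytic at no point of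
`K` form a `G_δ`, and those analytic nowhere on `𝕋ⁿ` are dense. The first is applied to `K = {ζ}`
and to `K = 𝕋ⁿ`.

`G_δ`: an expansion at `ζ` has, for some `m`, coefficients bounded by `(m+1)^(|k|+1)` and is valid
on a box of half-width `1/(2(m+1))`. For fixed `m` these coefficients form a compact set by
Tychonoff, and the expansion is a closed condition on `(f, ζ, a)`. Projecting along the compact set
of pairs `(ζ, a)` gives a closed set of `f`, so the functions analytic somewhere on `K` form an
`F_σ` (`isClosed_setOf_hasExpansion`).

Density uses no category argument. The series `g = ∑ e^{-2^j} z_i^{4^j}` lies in every `A^p`, yet is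
nowhere analytic on the circle (`not_analyticAt_lacunary`): its derivatives at `t = 0` grow too
fast, and a shift by `2πl/4^J` changes it only by a trigonometric polynomial. If `f + cg` is
analytic somewhere, it is analytic in the `i`-th variable at a point with rational arguments. No
such point serves two values of `c`, since subtracting would make `g` analytic there. Hence all but
countably many real `c` are good, and they may be taken arbitrarily small. -/

noncomputable section

/-! ### Partial derivatives of holomorphic functions -/

/-- Cauchy's estimate for the Fréchet derivative. -/
theorem norm_fderiv_le_of_norm_le_on_ball {E : Type*} [NormedAddCommGroup E] [NormedSpace ℂ E]
    {f : E → ℂ} {x : E} {r M : ℝ} (hr : 0 < r) (hM : 0 ≤ M)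
    (hf : DifferentiableOn ℂ f (Metric.ball x (2 * r)))
    (hb : ∀ y ∈ Metric.ball x (2 * r), ‖f y‖ ≤ M) : ‖fderiv ℂ f x‖ ≤ M / r := by
  refine ContinuousLinearMap.opNorm_le_bound _ (by positivity) fun u => ?_
  rcases eq_or_ne u 0 with rfl | hu
  · simp
  have hu' : 0 < ‖u‖ := norm_pos_iff.2 hu
  have hmem : ∀ w ∈ Metric.closedBall (0 : ℂ) (r / ‖u‖), x + w • u ∈ Metric.ball x (2 * r) := by
    intro w hw
    rw [mem_closedBall_zero_iff, le_div_iff₀ hu'] at hw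
    rw [mem_ball_iff_norm, add_sub_cancel_left, norm_smul]
    linarith
  have hline : DifferentiableOn ℂ (fun w : ℂ => f (x + w • u))
      (Metric.closedBall (0 : ℂ) (r / ‖u‖)) :=
    hf.comp (by fun_prop) hmem
  have hx : DifferentiableAt ℂ f x :=
    hf.differentiableAt (Metric.ball_mem_nhds x (by positivity))
  have h1 : deriv (fun w : ℂ => f (x + w • u)) 0 = fderiv ℂ f x u := hx.lineDeriv_eq_fderiv
  have h2 := Complex.norm_deriv_le_of_forall_mem_sphere_norm_le (c := 0) (R := r / ‖u‖) (C := M)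
    (f := fun w : ℂ => f (x + w • u)) (by positivity)
    (hline.mono Metric.closure_ball_subset_closedBall).diffContOnCl
    (fun w hw => hb _ (hmem w (Metric.sphere_subset_closedBall hw)))
  rw [h1] at h2
  refine h2.trans_eq ?_
  field_simp

/-- Directional derivatives of holomorphic functions of several variables are holomorphic. -/
theorem DifferentiableOn.lineDeriv_of_isOpen {E : Type*} [NormedAddCommGroup E] [NormedSpace ℂ E]
    [FiniteDimensional ℂ E] {f : E → ℂ} {U : Set E} (hU : IsOpen U) (hf : DifferentiableOn ℂ f U)
    (v : E) : DifferentiableOn ℂ (fun z => lineDeriv ℂ f z v) U := by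
  intro z₀ hz₀
  refine DifferentiableAt.differentiableWithinAt ?_
  have hcont : ContinuousAt f z₀ := (hf.differentiableAt (hU.mem_nhds hz₀)).continuousAt
  have hbdd : ∀ᶠ y in 𝓝 z₀, y ∈ U ∧ ‖f y‖ ≤ ‖f z₀‖ + 1 :=
    Filter.Eventually.and (hU.mem_nhds hz₀)
      ((hcont.norm.eventually_lt_const (lt_add_one _)).mono fun _ h => le_of_lt h)
  obtain ⟨R, hR, hball⟩ := Metric.eventually_nhds_iff_ball.1 hbdd
  set M := ‖f z₀‖ + 1 with hMdef
  have hM : 0 ≤ M := by positivity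
  -- The points `z + w • v` used below stay within `2r` of `z₀`, and Cauchy's estimate needs a
  -- further `2r` around each of them: `4r = R`.
  set r := R / 4 with hr
  have hr0 : 0 < r := by positivity
  set ρ := r / (‖v‖ + 1) with hρ
  have hv : 0 < ‖v‖ + 1 := by positivity
  have hρ0 : 0 < ρ := by positivity
  have hρv : ρ * ‖v‖ ≤ r := by
    rw [hρ, div_mul_eq_mul_div, div_le_iff₀ hv]; nlinarith [norm_nonneg v]
  have hmem : ∀ z ∈ Metric.ball z₀ r, ∀ w : ℂ, ‖w‖ ≤ ρ → z + w • v ∈ Metric.ball z₀ (2 * r) := by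
    intro z hz w hw
    rw [mem_ball_iff_norm] at hz ⊢
    have h1 : ‖w • v‖ ≤ ρ * ‖v‖ := by
      rw [norm_smul]; gcongr
    have h2 : ‖z + w • v - z₀‖ ≤ ‖z - z₀‖ + ‖w • v‖ := by
      rw [add_sub_right_comm]; exact norm_add_le _ _
    linarith
  have hfR : DifferentiableOn ℂ f (Metric.ball z₀ R) := hf.mono fun y hy => (hball y hy).1
  have h2R : Metric.ball z₀ (2 * r) ⊆ Metric.ball z₀ R := Metric.ball_subset_ball (by linarith)
  have hfd : ∀ y ∈ Metric.ball z₀ (2 * r), DifferentiableAt ℂ f y := fun y hy =>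
    hfR.differentiableAt (Metric.isOpen_ball.mem_nhds (h2R hy))
  have hfder : ∀ y ∈ Metric.ball z₀ (2 * r), ‖fderiv ℂ f y‖ ≤ M / r := by
    intro y hy
    have hsub : Metric.ball y (2 * r) ⊆ Metric.ball z₀ R :=
      Metric.ball_subset_ball' (by rw [Metric.mem_ball] at hy; linarith)
    exact norm_fderiv_le_of_norm_le_on_ball hr0 hM (hfR.mono hsub)
      fun x hx => (hball x (hsub hx)).2
  set c : ℝ → ℂ := fun θ => _root_.deriv (circleMap 0 ρ) θ * (1 / (circleMap 0 ρ θ - 0) ^ 2) with hc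
  have hcm : Continuous (circleMap (0 : ℂ) ρ) := continuous_circleMap 0 ρ
  have hne : ∀ θ, circleMap (0 : ℂ) ρ θ ≠ 0 := fun θ => circleMap_ne_center hρ0.ne'
  have hcc : Continuous c := by
    simp only [hc, deriv_circleMap, sub_zero]
    refine (by fun_prop : Continuous fun θ => circleMap (0 : ℂ) ρ θ * Complex.I).mul ?_
    exact continuous_const.div (hcm.pow 2) fun θ => pow_ne_zero 2 (hne θ)
  have hcirc : ∀ θ, ‖circleMap (0 : ℂ) ρ θ‖ ≤ ρ := fun θ => by
    simp [abs_of_pos hρ0]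
  -- In Cauchy's formula along direction `v`, `z` enters only through `f`, so the integral can be
  -- differentiated in `z` knowing only first derivatives of `f`.
  have hformula : ∀ z ∈ Metric.ball z₀ r, lineDeriv ℂ f z v =
      (2 * Real.pi * Complex.I : ℂ)⁻¹ • ∫ θ in (0 : ℝ)..2 * Real.pi,
        c θ • f (z + circleMap 0 ρ θ • v) := by
    intro z hz
    have hd : DifferentiableOn ℂ (fun w : ℂ => f (z + w • v)) (Metric.closedBall 0 ρ) := by
      intro w hw
      refine DifferentiableAt.differentiableWithinAt ?_
      exact (hfd _ (hmem z hz w (mem_closedBall_zero_iff.1 hw))).comp w (by fun_prop)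
    have h := hd.deriv_eq_smul_circleIntegral hρ0
    rw [lineDeriv, eq_inv_smul_iff₀ Complex.two_pi_I_ne_zero, ← h, circleIntegral]
    simp only [hc, smul_eq_mul, mul_assoc]
  have hev : (fun z => lineDeriv ℂ f z v) =ᶠ[𝓝 z₀] fun z =>
      (2 * Real.pi * Complex.I : ℂ)⁻¹ • ∫ θ in (0 : ℝ)..2 * Real.pi,
        c θ • f (z + circleMap 0 ρ θ • v) :=
    Filter.eventually_of_mem (Metric.ball_mem_nhds z₀ hr0) hformula
  refine DifferentiableAt.congr_of_eventuallyEq ?_ hev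
  suffices h : DifferentiableAt ℂ (fun z => ∫ θ in (0 : ℝ)..2 * Real.pi,
      c θ • f (z + circleMap 0 ρ θ • v)) z₀ from
    h.const_smul (2 * Real.pi * Complex.I : ℂ)⁻¹
  have hline : ∀ z ∈ Metric.ball z₀ r, Continuous fun θ => f (z + circleMap 0 ρ θ • v) := by
    intro z hz
    refine continuous_iff_continuousAt.2 fun θ => ?_
    exact ContinuousAt.comp (g := f) (f := fun θ => z + circleMap 0 ρ θ • v)
      (hfd _ (hmem z hz _ (hcirc θ))).continuousAt
      (by fun_prop : Continuous fun θ => z + circleMap 0 ρ θ • v).continuousAt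
  let _ : MeasurableSpace E := borel E
  have : BorelSpace E := ⟨rfl⟩
  let _ : MeasurableSpace (E →L[ℂ] ℂ) := borel _
  have : BorelSpace (E →L[ℂ] ℂ) := ⟨rfl⟩
  have : FiniteDimensional ℂ (E →L[ℂ] ℂ) := inferInstance
  have : ProperSpace (E →L[ℂ] ℂ) := FiniteDimensional.proper ℂ _
  have hmeas : Measurable fun θ => fderiv ℂ f (z₀ + circleMap 0 ρ θ • v) :=
    (measurable_fderiv ℂ f).comp
      (by fun_prop : Continuous fun θ => z₀ + circleMap 0 ρ θ • v).measurable
  have key := intervalIntegral.hasFDerivAt_integral_of_dominated_of_fderiv_le (𝕜 := ℂ)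
    (μ := MeasureTheory.volume) (a := 0) (b := 2 * Real.pi) (x₀ := z₀) (s := Metric.ball z₀ r)
    (F := fun z θ => c θ • f (z + circleMap 0 ρ θ • v))
    (F' := fun z θ => c θ • fderiv ℂ f (z + circleMap 0 ρ θ • v))
    (bound := fun θ => ‖c θ‖ * (M / r))
    (Metric.ball_mem_nhds z₀ hr0)
    (Filter.eventually_of_mem (Metric.ball_mem_nhds z₀ hr0)
      fun z hz => (hcc.smul (hline z hz)).aestronglyMeasurable)
    ((hcc.smul (hline z₀ (Metric.mem_ball_self hr0))).intervalIntegrable _ _)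
    (hcc.aestronglyMeasurable.smul hmeas.stronglyMeasurable.aestronglyMeasurable)
    (Filter.Eventually.of_forall fun θ _ z hz => by
      rw [norm_smul]
      exact mul_le_mul_of_nonneg_left (hfder _ (hmem z hz _ (hcirc θ))) (norm_nonneg _))
    ((hcc.norm.mul continuous_const).intervalIntegrable _ _)
    (Filter.Eventually.of_forall fun θ _ z hz => by
      have h := (hfd _ (hmem z hz _ (hcirc θ))).hasFDerivAt.comp z
        ((hasFDerivAt_id z).add_const (circleMap 0 ρ θ • v))
      exact h.const_smul (c θ))
  exact key.differentiableAt

/-! ### Mixed partial derivatives on the polydisc -/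

theorem isOpen_polydisc (n : ℕ) : IsOpen (polydisc n) := by
  simp only [polydisc, ofPred_forall]
  exact isOpen_iInter_of_finite fun i => isOpen_lt (by fun_prop) continuous_const

theorem polydisc_subset_closedPolydisc (n : ℕ) : polydisc n ⊆ closedPolydisc n :=
  fun _ hz i => (hz i).le

theorem isCompact_closedPolydisc (n : ℕ) : IsCompact (closedPolydisc n) := by
  have : closedPolydisc n = Set.pi univ fun _ => Metric.closedBall (0 : ℂ) 1 := by
    ext z; simp [closedPolydisc]
  rw [this]
  exact isCompact_univ_pi fun _ => isCompact_closedBall 0 1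

instance (n : ℕ) : CompactSpace (closedPolydisc n) :=
  isCompact_iff_compactSpace.1 (isCompact_closedPolydisc n)

/-- Three functions are carried at once so that a relation such as `h = f + c g` can be propagated.
-/
theorem mixedPartial_induction {n : ℕ}
    {P : ((Fin n → ℂ) → ℂ) → ((Fin n → ℂ) → ℂ) → ((Fin n → ℂ) → ℂ) → Prop}
    (step : ∀ (i : Fin n) f g h, P f g h →
      P (fun z => lineDeriv ℂ f z (Pi.single i 1)) (fun z => lineDeriv ℂ g z (Pi.single i 1))
        (fun z => lineDeriv ℂ h z (Pi.single i 1)))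
    (α : Fin n → ℕ) {f g h : (Fin n → ℂ) → ℂ} (h₀ : P f g h) :
    P (mixedPartial α f) (mixedPartial α g) (mixedPartial α h) := by
  simp only [mixedPartial]
  induction List.finRange n with
  | nil => exact h₀
  | cons i l ih =>
    simp only [List.foldr_cons]
    induction α i with
    | zero => exact ih
    | succ k ih' =>
      simp only [Function.iterate_succ', Function.comp_apply]
      exact step i _ _ _ ih'

theorem mixedPartial_zero {n : ℕ} (f : (Fin n → ℂ) → ℂ) : mixedPartial 0 f = f := by
  simp only [mixedPartial]
  induction List.finRange n with
  | nil => rfl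
  | cons i l ih => simp

theorem Set.EqOn.lineDeriv_of_isOpen {n : ℕ} {f g : (Fin n → ℂ) → ℂ} {U : Set (Fin n → ℂ)}
    (hU : IsOpen U) (h : EqOn f g U) (v : Fin n → ℂ) :
    EqOn (fun z => lineDeriv ℂ f z v) (fun z => lineDeriv ℂ g z v) U := fun _ hz =>
  Filter.EventuallyEq.lineDeriv_eq (Filter.eventually_of_mem (hU.mem_nhds hz) h)

theorem mixedPartial_add_const_mul {n : ℕ} {f g : (Fin n → ℂ) → ℂ}
    (hf : DifferentiableOn ℂ f (polydisc n)) (hg : DifferentiableOn ℂ g (polydisc n)) (c : ℂ)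
    (α : Fin n → ℕ) :
    EqOn (mixedPartial α fun z => f z + c * g z)
      (fun z => mixedPartial α f z + c * mixedPartial α g z) (polydisc n) := by
  refine (mixedPartial_induction (P := fun f g h => DifferentiableOn ℂ f (polydisc n) ∧
    DifferentiableOn ℂ g (polydisc n) ∧ EqOn h (fun z => f z + c * g z) (polydisc n))
    ?_ α ⟨hf, hg, fun _ _ => rfl⟩).2.2
  rintro i f g h ⟨hf, hg, hh⟩
  refine ⟨hf.lineDeriv_of_isOpen (isOpen_polydisc n) _,
    hg.lineDeriv_of_isOpen (isOpen_polydisc n) _, fun z hz => ?_⟩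
  have hnhds := (isOpen_polydisc n).mem_nhds hz
  have hfz := (hf.differentiableAt hnhds).hasFDerivAt.hasLineDerivAt (Pi.single i 1)
  have hgz := (hg.differentiableAt hnhds).hasFDerivAt.hasLineDerivAt (Pi.single i 1)
  have hfg : HasLineDerivAt ℂ (fun w => f w + c * g w) _ z (Pi.single i 1) :=
    HasDerivAt.add hfz (HasDerivAt.const_mul c hgz)
  refine (hh.lineDeriv_of_isOpen (isOpen_polydisc n) _ hz).trans ?_
  simp only [hfg.lineDeriv, hfz.lineDeriv, hgz.lineDeriv]

/-! ### The topological vector space operations used on `A^p(Dⁿ)` -/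

theorem zeroExtend_apply {n : ℕ} (f : closedPolydisc n → ℂ) (z : closedPolydisc n) :
    zeroExtend f z = f z := Subtype.val_injective.extend_apply f 0 z

theorem zeroExtend_add_const_mul {n : ℕ} (f g : closedPolydisc n → ℂ) (c : ℂ) :
    zeroExtend (fun z => f z + c * g z) = fun z => zeroExtend f z + c * zeroExtend g z := by
  ext z
  by_cases hz : z ∈ closedPolydisc n
  · simp only [zeroExtend_apply _ ⟨z, hz⟩]
  · have hz' : ¬ ∃ a : closedPolydisc n, a.1 = z := by rintro ⟨a, rfl⟩; exact hz a.2
    simp [zeroExtend, Function.extend_apply' _ _ _ hz']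

namespace PolydiscAlgebra

variable {n : ℕ} {p : ℕ∞}

/-- The element `f + c g` of `A^p(Dⁿ)`. -/
def addConstMul (f g : PolydiscAlgebra n p) (c : ℂ) : PolydiscAlgebra n p where
  toContinuousMap := ⟨fun z => f.toContinuousMap z + c * g.toContinuousMap z, by fun_prop⟩
  holomorphic := by
    simp only [ContinuousMap.coe_mk, zeroExtend_add_const_mul]
    exact f.holomorphic.add (g.holomorphic.const_mul c)
  partials_extend α hα := by
    obtain ⟨u, hu, hfu⟩ := f.partials_extend α hα
    obtain ⟨v, hv, hgv⟩ := g.partials_extend α hα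
    refine ⟨fun z => u z + c * v z, hu.add (continuousOn_const.mul hv), fun z hz => ?_⟩
    simp only [ContinuousMap.coe_mk, zeroExtend_add_const_mul]
    refine (mixedPartial_add_const_mul f.holomorphic g.holomorphic c α hz).trans ?_
    simp only [hfu hz, hgv hz]

theorem addConstMul_restrictTorus (f g : PolydiscAlgebra n p) (c : ℂ) (ζ : Fin n → Circle) :
    (f.addConstMul g c).restrictTorus ζ = f.restrictTorus ζ + c * g.restrictTorus ζ := rfl

theorem isInducing_partials :
    IsInducing (partials : PolydiscAlgebra n p → _) := ⟨rfl⟩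

theorem tendsto_iff {ι : Type*} {l : Filter ι} {F : ι → PolydiscAlgebra n p}
    {f : PolydiscAlgebra n p} :
    Filter.Tendsto F l (𝓝 f) ↔ ∀ α : Fin n → ℕ, ((∑ i, α i : ℕ) : ℕ∞) ≤ p →
      ∀ ε > 0, ∀ᶠ j in l, ∀ z ∈ polydisc n,
        dist (mixedPartial α (zeroExtend f.toContinuousMap) z)
          (mixedPartial α (zeroExtend (F j).toContinuousMap) z) < ε := by
  rw [isInducing_partials.tendsto_nhds_iff, tendsto_pi_nhds, Subtype.forall]
  refine forall₂_congr fun α hα => ?_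
  rw [UniformFun.tendsto_iff_tendstoUniformly, Metric.tendstoUniformly_iff]
  simp only [Subtype.forall]
  rfl

theorem tendsto_addConstMul (f g : PolydiscAlgebra n p) :
    Filter.Tendsto (fun c : ℝ => f.addConstMul g c) (𝓝 0) (𝓝 f) := by
  rw [tendsto_iff]
  intro α hα ε hε
  obtain ⟨v, hv, hgv⟩ := g.partials_extend α hα
  obtain ⟨M, hM⟩ := (isCompact_closedPolydisc n).exists_bound_of_continuousOn hv
  have hlim : Filter.Tendsto (fun c : ℝ => |c| * M) (𝓝 0) (𝓝 0) := by
    have : Continuous fun c : ℝ => |c| * M := by fun_prop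
    simpa using this.tendsto 0
  filter_upwards [hlim.eventually_lt_const hε] with c hc z hz
  have h1 : mixedPartial α (zeroExtend (f.addConstMul g c).toContinuousMap) z =
      mixedPartial α (zeroExtend f.toContinuousMap) z +
        c * mixedPartial α (zeroExtend g.toContinuousMap) z := by
    refine Eq.trans ?_ (mixedPartial_add_const_mul f.holomorphic g.holomorphic c α hz)
    rw [← zeroExtend_add_const_mul]
    rfl
  rw [h1, dist_self_add_right, norm_mul, Complex.norm_real, Real.norm_eq_abs, hgv hz]
  exact (mul_le_mul_of_nonneg_left (hM z (polydisc_subset_closedPolydisc n hz))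
    (abs_nonneg c)).trans_lt hc

theorem dense_polydisc (n : ℕ) : Dense {w : closedPolydisc n | w.1 ∈ polydisc n} := by
  intro w
  have hr : ∀ k : ℕ, 0 ≤ 1 - 1 / ((k : ℝ) + 1) ∧ 1 - 1 / ((k : ℝ) + 1) < 1 := fun k => by
    refine ⟨?_, ?_⟩
    · rw [sub_nonneg, div_le_one (by positivity)]; linarith [(Nat.cast_nonneg k : (0 : ℝ) ≤ k)]
    · linarith [(by positivity : 0 < 1 / ((k : ℝ) + 1))]
  have hnorm : ∀ (k : ℕ) i, ‖((1 - 1 / ((k : ℝ) + 1)) • w.1) i‖ < 1 := fun k i => by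
    rw [Pi.smul_apply, norm_smul, Real.norm_of_nonneg (hr k).1]
    exact (mul_le_of_le_one_right (hr k).1 (w.2 i)).trans_lt (hr k).2
  refine mem_closure_of_tendsto (b := Filter.atTop)
    (f := fun k : ℕ => (⟨(1 - 1 / ((k : ℝ) + 1)) • w.1, fun i => (hnorm k i).le⟩ :
      closedPolydisc n)) ?_ (Filter.Eventually.of_forall fun k i => hnorm k i)
  rw [tendsto_subtype_rng]
  have := ((tendsto_const_nhds (x := (1 : ℝ))).sub
    (tendsto_one_div_add_atTop_nhds_zero_nat (𝕜 := ℝ))).smul (tendsto_const_nhds (x := w.1))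
  simpa using this

/-- The seminorm with `α = 0`, admitted for every `p`, is a supremum over the open polydisc. By
density the non-strict bound passes to the closed one. -/
theorem continuous_toContinuousMap :
    Continuous (toContinuousMap : PolydiscAlgebra n p → C(closedPolydisc n, ℂ)) := by
  rw [continuous_iff_continuousAt]
  intro f
  rw [ContinuousAt, ContinuousMap.tendsto_iff_tendstoUniformly, Metric.tendstoUniformly_iff]
  intro ε hε
  filter_upwards [tendsto_iff.1 (Filter.tendsto_id (x := 𝓝 f)) 0 (by simp) (ε / 2) (half_pos hε)]
    with g hg w
  refine lt_of_le_of_lt ?_ (half_lt_self hε)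
  have hclosed : IsClosed {w | dist (f.toContinuousMap w) (g.toContinuousMap w) ≤ ε / 2} :=
    isClosed_le (by fun_prop) continuous_const
  refine closure_minimal (fun w hw => ?_) hclosed (dense_polydisc n w)
  have := hg w hw
  simp only [mixedPartial_zero, zeroExtend_apply, id] at this
  exact this.le

theorem continuous_restrictTorus :
    Continuous fun q : PolydiscAlgebra n p × (Fin n → Circle) => q.1.restrictTorus q.2 := by
  have h : Continuous fun q : PolydiscAlgebra n p × (Fin n → Circle) =>
      (⟨fun i => (q.2 i : ℂ), fun i => (Circle.norm_coe (q.2 i)).le⟩ : closedPolydisc n) := by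
    refine Continuous.subtype_mk ?_ _
    exact continuous_pi fun i =>
      continuous_subtype_val.comp ((continuous_apply i).comp continuous_snd)
  exact (continuous_toContinuousMap.comp continuous_fst).eval h

end PolydiscAlgebra

/-! ### Functions real analytic at some point of a closed set form an `F_σ` set -/

/-- A finite set of multi-indices lies in a cube, over which the sum factors into geometric sums,
each at most `2`. -/
theorem summable_half_pow_sum (n : ℕ) :
    Summable fun k : Fin n → ℕ => (1 / 2 : ℝ) ^ ∑ i, k i := by
  refine summable_of_sum_le (c := ∏ _i : Fin n, (2 : ℝ)) (fun k => by positivity) fun u => ?_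
  classical
  let N : ℕ := (u.sup fun k => ∑ i, k i) + 1
  have hsub : u ⊆ Fintype.piFinset fun _ : Fin n => Finset.range N := by
    intro k hk
    rw [Fintype.mem_piFinset]
    intro i
    rw [Finset.mem_range, Nat.lt_succ_iff]
    exact (Finset.single_le_sum (fun j _ => Nat.zero_le (k j)) (Finset.mem_univ i)).trans
      (Finset.le_sup (f := fun k : Fin n → ℕ => ∑ i, k i) hk)
  calc ∑ k ∈ u, (1 / 2 : ℝ) ^ ∑ i, k i
      ≤ ∑ k ∈ Fintype.piFinset fun _ : Fin n => Finset.range N, (1 / 2 : ℝ) ^ ∑ i, k i :=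
        Finset.sum_le_sum_of_subset_of_nonneg hsub fun _ _ _ => by positivity
    _ = ∏ _i : Fin n, ∑ j ∈ Finset.range N, (1 / 2 : ℝ) ^ j := by
        rw [Finset.prod_univ_sum]
        simp only [Finset.prod_pow_eq_pow_sum]
    _ ≤ ∏ _i : Fin n, (2 : ℝ) := by
        refine Finset.prod_le_prod (fun _ _ => Finset.sum_nonneg fun _ _ => by positivity)
          fun _ _ => ?_
        exact (summable_geometric_two.sum_le_tsum _ fun _ _ => by positivity).trans_eq
          tsum_geometric_two

/-- `F (ζ₁ e^{is₁}, …, ζₙ e^{isₙ})` is the sum of the power series in `s` with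
coefficients `a` on the box of half-width `1 / (2 (m + 1))`. -/
def HasExpansion {n : ℕ} (m : ℕ) (F : (Fin n → Circle) → ℂ) (ζ : Fin n → Circle)
    (a : (Fin n → ℕ) → ℂ) : Prop :=
  ∀ s : Fin n → ℝ, (∀ i, |s i| ≤ 1 / (2 * (m + 1 : ℝ))) →
    F (fun i => ζ i * Circle.exp (s i)) = ∑' k : Fin n → ℕ, a k * ∏ i, (s i : ℂ) ^ k i

/-- The coefficients admitted in expansions of level `m`. -/
def expansionCoeffs (n m : ℕ) : Set ((Fin n → ℕ) → ℂ) :=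
  {a | ∀ k, ‖a k‖ ≤ (m + 1 : ℝ) * (m + 1 : ℝ) ^ ∑ i, k i}

theorem isCompact_expansionCoeffs (n m : ℕ) : IsCompact (expansionCoeffs n m) := by
  have : expansionCoeffs n m = Set.pi univ fun k : Fin n → ℕ =>
      Metric.closedBall (0 : ℂ) ((m + 1 : ℝ) * (m + 1 : ℝ) ^ ∑ i, k i) := by
    ext a; simp [expansionCoeffs]
  rw [this]
  exact isCompact_univ_pi fun _ => isCompact_closedBall _ _

theorem norm_monomial_le {n : ℕ} {s : Fin n → ℝ} {r : ℝ} (hs : ∀ i, |s i| ≤ r)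
    (k : Fin n → ℕ) : ‖∏ i, (s i : ℂ) ^ k i‖ ≤ r ^ ∑ i, k i := by
  rw [norm_prod, ← Finset.prod_pow_eq_pow_sum]
  refine Finset.prod_le_prod (fun _ _ => norm_nonneg _) fun i _ => ?_
  rw [norm_pow, Complex.norm_real, Real.norm_eq_abs]
  exact pow_le_pow_left₀ (abs_nonneg _) (hs i) _

theorem norm_term_le_of_mem_expansionCoeffs {n m : ℕ} {a : (Fin n → ℕ) → ℂ}
    (ha : a ∈ expansionCoeffs n m) {s : Fin n → ℝ}
    (hs : ∀ i, |s i| ≤ 1 / (2 * (m + 1 : ℝ))) (k : Fin n → ℕ) :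
    ‖a k * ∏ i, (s i : ℂ) ^ k i‖ ≤ (m + 1 : ℝ) * (1 / 2 : ℝ) ^ ∑ i, k i := by
  rw [norm_mul]
  refine (mul_le_mul (ha k) (norm_monomial_le hs k) (norm_nonneg _) (by positivity)).trans_eq ?_
  rw [mul_assoc, ← mul_pow]
  congr 2
  field_simp

/-- Absolute convergence at the corner `θ + δ` bounds `‖a k‖ δ^|k|`; any `m` above both the sum
there and `δ⁻¹` works. Conversely, on the box of level `m` the terms are dominated by `(m+1)
2^{-|k|}`. -/
theorem torusRealAnalyticAt_iff {n : ℕ} (F : (Fin n → Circle) → ℂ) (ζ : Fin n → Circle) :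
    TorusRealAnalyticAt F ζ ↔ ∃ m : ℕ, ∃ a ∈ expansionCoeffs n m, HasExpansion m F ζ a := by
  constructor
  · rintro ⟨θ, hθ, a, δ, hδ, hsum, hF⟩
    have hcorner := hsum (fun i => θ i + δ) ⟨fun i => by dsimp; linarith, fun i => le_rfl⟩
    simp only [add_sub_cancel_left, Finset.prod_pow_eq_pow_sum, norm_mul, norm_pow,
      Complex.norm_real, Real.norm_eq_abs, abs_of_pos hδ] at hcorner
    obtain ⟨m, hm⟩ := exists_nat_ge
      (max (∑' k : Fin n → ℕ, ‖a k‖ * δ ^ ∑ i, k i) δ⁻¹)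
    have hm1 : ∑' k : Fin n → ℕ, ‖a k‖ * δ ^ ∑ i, k i ≤ m + 1 := by
      linarith [(le_max_left _ _).trans hm]
    have hm2 : δ⁻¹ ≤ m + 1 := by linarith [(le_max_right _ _).trans hm]
    have hm3 : 1 / (2 * (m + 1 : ℝ)) ≤ δ := by
      rw [div_le_iff₀ (by positivity)]
      have := mul_le_mul_of_nonneg_left hm2 hδ.le
      rw [mul_inv_cancel₀ hδ.ne'] at this
      nlinarith
    refine ⟨m, a, fun k => ?_, fun s hs => ?_⟩
    · have h1 : ‖a k‖ * δ ^ ∑ i, k i ≤ m + 1 :=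
        (hcorner.le_tsum k fun _ _ => by positivity).trans hm1
      calc ‖a k‖ = ‖a k‖ * δ ^ (∑ i, k i) * δ⁻¹ ^ ∑ i, k i := by
            rw [mul_assoc, ← mul_pow, mul_inv_cancel₀ hδ.ne', one_pow, mul_one]
        _ ≤ _ := by gcongr
    · have hmem : (fun i => θ i + s i) ∈ Icc (fun i => θ i - δ) (fun i => θ i + δ) := by
        refine ⟨fun i => ?_, fun i => ?_⟩ <;>
          have := abs_le.1 ((hs i).trans hm3) <;> dsimp <;> linarith
      have := (hF.hasSum hmem).tsum_eq
      simp only [add_sub_cancel_left, Circle.exp_add, hθ] at this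
      exact this.symm
  · rintro ⟨m, a, ha, hF⟩
    have hδ : 0 < 1 / (2 * (m + 1 : ℝ)) := by positivity
    refine ⟨fun i => Complex.arg (ζ i), fun i => Circle.exp_arg _, a, _, hδ, ?_⟩
    have hs : ∀ t ∈ Icc (fun i => Complex.arg (ζ i) - 1 / (2 * (m + 1 : ℝ)))
        (fun i => Complex.arg (ζ i) + 1 / (2 * (m + 1 : ℝ))),
        ∀ i, |t i - Complex.arg (ζ i)| ≤ 1 / (2 * (m + 1 : ℝ)) := by
      intro t ht i
      have h1 := ht.1 i
      have h2 := ht.2 i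
      dsimp at h1 h2
      rw [abs_le]
      constructor <;> linarith
    have hu := (summable_half_pow_sum n).mul_left (m + 1 : ℝ)
    refine ⟨fun t ht => ?_, ?_⟩
    · exact hu.of_nonneg_of_le (fun _ => norm_nonneg _)
        (norm_term_le_of_mem_expansionCoeffs ha (hs t ht))
    · refine (HasSumUniformlyOn.of_norm_le_summable hu fun k t ht =>
        norm_term_le_of_mem_expansionCoeffs ha (hs t ht) k).congr_right fun t ht => ?_
      dsimp only
      rw [← hF _ (hs t ht)]
      congr 1
      ext i
      rw [← Circle.exp_arg (ζ i), ← Circle.exp_add, Circle.exp_arg, add_sub_cancel]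

namespace PolydiscAlgebra

variable {n : ℕ} {p : ℕ∞}

/-- For each fixed `s` both sides of the expansion are continuous in `(f, ζ, a)`, the series by
uniform domination; projection along a compact factor is a closed map. -/
theorem isClosed_setOf_hasExpansion (m : ℕ) {K : Set (Fin n → Circle)} (hK : IsClosed K) :
    IsClosed {f : PolydiscAlgebra n p | ∃ ζ ∈ K, ∃ a ∈ expansionCoeffs n m,
      HasExpansion m f.restrictTorus ζ a} := by
  have : CompactSpace (expansionCoeffs n m) :=
    isCompact_iff_compactSpace.1 (isCompact_expansionCoeffs n m)
  have : CompactSpace K := isCompact_iff_compactSpace.1 hK.isCompact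
  have hclosed : IsClosed {q : PolydiscAlgebra n p × (K × expansionCoeffs n m) |
      HasExpansion m q.1.restrictTorus q.2.1 q.2.2} := by
    simp only [HasExpansion, ofPred_forall]
    refine isClosed_iInter fun s => isClosed_iInter fun hs => isClosed_eq ?_ ?_
    · refine continuous_restrictTorus.comp (continuous_fst.prodMk (continuous_pi fun i => ?_))
      exact ((continuous_apply i).comp
        (continuous_subtype_val.comp (continuous_fst.comp continuous_snd))).mul continuous_const
    · refine continuous_tsum (fun k => ?_) ((summable_half_pow_sum n).mul_left (m + 1 : ℝ))
        fun k q => norm_term_le_of_mem_expansionCoeffs q.2.2.2 hs k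
      exact ((continuous_apply k).comp
        (continuous_subtype_val.comp (continuous_snd.comp continuous_snd))).mul continuous_const
  convert isClosedMap_fst_of_compactSpace _ hclosed using 1
  ext f
  simp

theorem isGδ_setOf_not_torusRealAnalyticAt {K : Set (Fin n → Circle)} (hK : IsClosed K) :
    IsGδ {f : PolydiscAlgebra n p | ∀ ζ ∈ K, ¬ TorusRealAnalyticAt f.restrictTorus ζ} := by
  have : {f : PolydiscAlgebra n p | ∀ ζ ∈ K, ¬ TorusRealAnalyticAt f.restrictTorus ζ} =
      ⋂ m : ℕ, {f : PolydiscAlgebra n p | ∃ ζ ∈ K, ∃ a ∈ expansionCoeffs n m,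
        HasExpansion m f.restrictTorus ζ a}ᶜ := by
    ext f
    simp only [torusRealAnalyticAt_iff, mem_iInter, mem_compl_iff, mem_ofPred_eq]
    push Not
    exact ⟨fun h m ζ hζ => h ζ hζ m, fun h ζ hζ m => h m ζ hζ⟩
  rw [this]
  exact .iInter_of_isOpen fun m => (isClosed_setOf_hasExpansion m hK).isOpen_compl

end PolydiscAlgebra

/-! ### A lacunary series that is nowhere real analytic on the circle -/

/-- Rapidly decreasing sequences of coefficients. -/
def RapidlyDecreasing (c : ℕ → ℂ) : Prop := ∀ m : ℕ, Summable fun k : ℕ => ‖c k‖ * (k : ℝ) ^ m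

theorem RapidlyDecreasing.summable_norm {c : ℕ → ℂ} (hc : RapidlyDecreasing c) :
    Summable fun k => ‖c k‖ := by simpa using hc 0

/-- The trigonometric series `∑ cₖ e^{ikt}`. -/
def trigSum (c : ℕ → ℂ) (t : ℝ) : ℂ := ∑' k : ℕ, c k * Complex.exp (k * t * Complex.I)

theorem norm_exp_natCast_mul_I (k : ℕ) (t : ℝ) : ‖Complex.exp (k * t * Complex.I)‖ = 1 := by
  rw [← Complex.norm_exp_ofReal_mul_I (k * t)]; push_cast; rfl

theorem RapidlyDecreasing.summable_trigSum {c : ℕ → ℂ} (hc : RapidlyDecreasing c) (t : ℝ) :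
    Summable fun k : ℕ => c k * Complex.exp (k * t * Complex.I) :=
  Summable.of_norm (by simpa [norm_mul, norm_exp_natCast_mul_I] using hc.summable_norm)

theorem RapidlyDecreasing.mul_natCast_mul_I {c : ℕ → ℂ} (hc : RapidlyDecreasing c) :
    RapidlyDecreasing fun k => c k * (k * Complex.I) := fun m => by
  refine (hc (m + 1)).congr fun k => ?_
  simp [pow_succ]; ring

theorem RapidlyDecreasing.hasDerivAt_trigSum {c : ℕ → ℂ} (hc : RapidlyDecreasing c) (t : ℝ) :
    HasDerivAt (trigSum c) (trigSum (fun k => c k * (k * Complex.I)) t) t := by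
  have hterm : ∀ (k : ℕ) (t : ℝ),
      HasDerivAt (fun s : ℝ => c k * Complex.exp (k * s * Complex.I))
        (c k * (k * Complex.I) * Complex.exp (k * t * Complex.I)) t := fun k t => by
    have h : HasDerivAt (fun s : ℝ => (k : ℂ) * s * Complex.I) (k * Complex.I) t := by
      simpa using ((Complex.ofRealCLM.hasDerivAt (x := t)).const_mul (k : ℂ)).mul_const Complex.I
    convert! h.cexp.const_mul (c k) using 1
    ring
  have hbound : ∀ (k : ℕ) (t : ℝ),
      ‖c k * (k * Complex.I) * Complex.exp (k * t * Complex.I)‖ ≤ ‖c k * (k * Complex.I)‖ :=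
    fun k t => by rw [norm_mul, norm_exp_natCast_mul_I, mul_one]
  exact hasDerivAt_tsum hc.mul_natCast_mul_I.summable_norm hterm hbound (hc.summable_trigSum 0) t

theorem RapidlyDecreasing.iteratedDeriv_trigSum {c : ℕ → ℂ} (hc : RapidlyDecreasing c) (m : ℕ) :
    iteratedDeriv m (trigSum c) = trigSum fun k => c k * (k * Complex.I) ^ m := by
  induction m generalizing c with
  | zero => simp
  | succ m ih =>
    rw [iteratedDeriv_succ', funext fun t => (hc.hasDerivAt_trigSum t).deriv,
      ih hc.mul_natCast_mul_I]
    simp only [pow_succ', mul_assoc]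

/-- The coefficients `e^{-√k}` supported on the powers of `4`. -/
def lacunaryCoeff (k : ℕ) : ℝ := by
  classical exact if ∃ j : ℕ, k = 4 ^ j then Real.exp (-√k) else 0

theorem lacunaryCoeff_nonneg (k : ℕ) : 0 ≤ lacunaryCoeff k := by
  unfold lacunaryCoeff; split_ifs <;> positivity

theorem lacunaryCoeff_le (k : ℕ) : lacunaryCoeff k ≤ Real.exp (-√k) := by
  unfold lacunaryCoeff; split_ifs
  · exact le_rfl
  · positivity

theorem lacunaryCoeff_four_pow (j : ℕ) : lacunaryCoeff (4 ^ j) = Real.exp (-2 ^ j) := by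
  have h : √((4 ^ j : ℕ) : ℝ) = 2 ^ j := by
    rw [Real.sqrt_eq_iff_mul_self_eq (by positivity) (by positivity)]
    push_cast
    rw [← mul_pow]; norm_num
  rw [lacunaryCoeff, if_pos ⟨j, rfl⟩, h]

theorem lacunaryCoeff_zero : lacunaryCoeff 0 = 0 :=
  if_neg fun ⟨j, hj⟩ => (by positivity : (0 : ℕ) < 4 ^ j).ne hj

/-- One term of the exponential series at `√k` gives `k^(m+2) ≤ (2(m+2))! e^{√k}`, whence a bound by
a multiple of `1/k²`. -/
theorem rapidlyDecreasing_lacunaryCoeff : RapidlyDecreasing fun k => (lacunaryCoeff k : ℂ) := by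
  intro m
  refine ((Real.summable_one_div_nat_pow.2 (one_lt_two)).mul_left
    (Nat.factorial (2 * (m + 2)) : ℝ)).of_nonneg_of_le (fun k => by positivity) fun k => ?_
  rw [Complex.norm_real, Real.norm_of_nonneg (lacunaryCoeff_nonneg k)]
  rcases Nat.eq_zero_or_pos k with rfl | hk
  · simp [lacunaryCoeff_zero]
  have hk' : (0 : ℝ) < k := Nat.cast_pos.2 hk
  have h := Real.pow_div_factorial_le_exp (√k) (Real.sqrt_nonneg _) (2 * (m + 2))
  rw [pow_mul, Real.sq_sqrt hk'.le, div_le_iff₀ (by positivity)] at h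
  rw [mul_one_div, le_div_iff₀ (by positivity), mul_assoc, ← pow_add]
  calc lacunaryCoeff k * (k : ℝ) ^ (m + 2)
      ≤ Real.exp (-√k) * (Real.exp √k * Nat.factorial (2 * (m + 2))) :=
        mul_le_mul (lacunaryCoeff_le k) h (by positivity) (by positivity)
    _ = Nat.factorial (2 * (m + 2)) := by rw [← mul_assoc, ← Real.exp_add]; simp

theorem AnalyticAt.exists_norm_iteratedDeriv_le {h : ℝ → ℂ} {x : ℝ} (hh : AnalyticAt ℝ h x) :
    ∃ C R : ℝ, 0 < C ∧ 0 < R ∧ ∀ m : ℕ, ‖iteratedDeriv m h x‖ ≤ C * R ^ m * Nat.factorial m := by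
  obtain ⟨q, r, hq⟩ := hh
  obtain ⟨s, hs, hsr⟩ := ENNReal.lt_iff_exists_nnreal_btwn.1 hq.r_pos
  have hs0 : 0 < s := by simpa using hs
  obtain ⟨C, hC, hCq⟩ := q.norm_le_div_pow_of_pos_of_lt_radius hs0 (hsr.trans_le hq.r_le)
  refine ⟨C, (s : ℝ)⁻¹, hC, by positivity, fun m => ?_⟩
  rw [iteratedDeriv, ← hq.factorial_smul (1 : ℝ) m, nsmul_eq_mul, norm_mul, mul_comm]
  have h1 : ‖q m fun _ => (1 : ℝ)‖ ≤ C / (s : ℝ) ^ m := by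
    refine ((q m).le_opNorm _).trans ?_
    simpa using hCq m
  rw [div_eq_mul_inv, ← inv_pow] at h1
  simpa using mul_le_mul_of_nonneg_right h1 (Nat.cast_nonneg (α := ℝ) (Nat.factorial m))

/-- At `t = 0` all terms of the `m`-th derivative share the phase `I ^ m`, so nothing cancels and
any single term is a lower bound. -/
theorem le_norm_iteratedDeriv_lacunary (m j : ℕ) :
    Real.exp (-2 ^ j) * (4 ^ j : ℝ) ^ m ≤
      ‖iteratedDeriv m (trigSum fun k => (lacunaryCoeff k : ℂ)) 0‖ := by
  rw [rapidlyDecreasing_lacunaryCoeff.iteratedDeriv_trigSum, trigSum]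
  have h1 : ∀ k : ℕ, (lacunaryCoeff k : ℂ) * (k * Complex.I) ^ m *
      Complex.exp (k * (0 : ℝ) * Complex.I) =
      Complex.I ^ m * ((lacunaryCoeff k * (k : ℝ) ^ m : ℝ) : ℂ) := fun k => by
    push_cast; simp [mul_pow]; ring
  have hnn : ∀ k : ℕ, 0 ≤ lacunaryCoeff k * (k : ℝ) ^ m := fun k =>
    mul_nonneg (lacunaryCoeff_nonneg k) (by positivity)
  have hs : Summable fun k : ℕ => lacunaryCoeff k * (k : ℝ) ^ m := by
    refine (rapidlyDecreasing_lacunaryCoeff m).congr fun k => ?_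
    rw [Complex.norm_real, Real.norm_of_nonneg (lacunaryCoeff_nonneg k)]
  rw [tsum_congr h1, tsum_mul_left, norm_mul, norm_pow, Complex.norm_I, one_pow, one_mul,
    ← Complex.ofReal_tsum, Complex.norm_real, Real.norm_of_nonneg (tsum_nonneg hnn)]
  have := hs.le_tsum (4 ^ j) fun k _ => hnn k
  simpa [lacunaryCoeff_four_pow] using this

theorem not_analyticAt_zero_lacunary :
    ¬ AnalyticAt ℝ (trigSum fun k => (lacunaryCoeff k : ℂ)) 0 := by
  intro h
  obtain ⟨C, R, hC, hR, hbound⟩ := h.exists_norm_iteratedDeriv_le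
  -- With `M = 2^j` the frequency is `4^j = M²`, so the derivative of order `M` is at least `e^{-M}
  -- M^{2M}`, against `C R^M M! ≤ C R^M M^M`. Thus `M^M ≤ C (R e)^M`; as `M > j ≥ 2 R e`, this
  -- forces `2^M ≤ C ≤ j < M`.
  obtain ⟨j, hj⟩ := exists_nat_ge (max C (2 * (R * Real.exp 1)))
  have hjC : C ≤ j := (le_max_left _ _).trans hj
  have hjR : 2 * (R * Real.exp 1) ≤ j := (le_max_right _ _).trans hj
  set M : ℕ := 2 ^ j with hM
  have hjM : j < M := Nat.lt_two_pow_self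
  have hMpos : (0 : ℝ) < M := by positivity
  have h1 := (le_norm_iteratedDeriv_lacunary M j).trans (hbound M)
  have hfact : (Nat.factorial M : ℝ) ≤ (M : ℝ) ^ M := by exact_mod_cast Nat.factorial_le_pow M
  have h4 : (4 ^ j : ℝ) = M * M := by
    rw [hM]; push_cast; rw [← mul_pow]; norm_num
  have hexp : Real.exp (-2 ^ j) * Real.exp 1 ^ M = 1 := by
    rw [← Real.exp_nat_mul, ← Real.exp_add, hM]; simp
  have h2 : (M : ℝ) ^ M ≤ C * (R * Real.exp 1) ^ M := by
    have h3 : Real.exp (-2 ^ j) * ((M : ℝ) ^ M * (M : ℝ) ^ M) ≤ C * R ^ M * (M : ℝ) ^ M := by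
      rw [h4, mul_pow] at h1
      exact h1.trans (mul_le_mul_of_nonneg_left hfact (by positivity))
    rw [← mul_assoc] at h3
    have h5 := le_of_mul_le_mul_right h3 (by positivity)
    have h6 := mul_le_mul_of_nonneg_right h5 (by positivity : 0 ≤ Real.exp 1 ^ M)
    rw [mul_right_comm, hexp, one_mul] at h6
    rw [mul_pow]; linarith
  have h7 : (2 * (R * Real.exp 1)) ^ M ≤ (M : ℝ) ^ M := by
    refine pow_le_pow_left₀ (by positivity) (hjR.trans ?_) _
    exact_mod_cast hjM.le
  rw [mul_pow] at h7
  have h8 : (2 : ℝ) ^ M ≤ C := le_of_mul_le_mul_right (h7.trans h2) (by positivity)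
  have h9 : (M : ℝ) < 2 ^ M := by exact_mod_cast Nat.lt_two_pow_self
  have h10 : (j : ℝ) < M := by exact_mod_cast hjM
  linarith

/-- The frequencies `4^j` with `j ≥ J` are multiples of `4^J`, so their terms are unchanged by the
shift and only finitely many others remain. -/
theorem analyticAt_trigSum_lacunary_sub (J : ℕ) (l : ℤ) (t : ℝ) :
    AnalyticAt ℝ (fun t => trigSum (fun k => (lacunaryCoeff k : ℂ))
        (t + 2 * Real.pi / 4 ^ J * l) - trigSum (fun k => (lacunaryCoeff k : ℂ)) t) t := by
  have key : ∀ t : ℝ, trigSum (fun k => (lacunaryCoeff k : ℂ)) (t + 2 * Real.pi / 4 ^ J * l) -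
      trigSum (fun k => (lacunaryCoeff k : ℂ)) t = ∑ k ∈ Finset.range (4 ^ J),
        ((lacunaryCoeff k : ℂ) * Complex.exp (k * (t + 2 * Real.pi / 4 ^ J * l : ℝ) * Complex.I) -
          (lacunaryCoeff k : ℂ) * Complex.exp (k * t * Complex.I)) := by
    intro t
    rw [trigSum, trigSum, ← (rapidlyDecreasing_lacunaryCoeff.summable_trigSum _).tsum_sub
      (rapidlyDecreasing_lacunaryCoeff.summable_trigSum _)]
    refine tsum_eq_sum fun k hk => ?_
    rw [Finset.mem_range, not_lt] at hk
    by_cases hk4 : ∃ j : ℕ, k = 4 ^ j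
    · obtain ⟨j, rfl⟩ := hk4
      obtain ⟨i, rfl⟩ := Nat.exists_eq_add_of_le ((Nat.pow_le_pow_iff_right (by norm_num)).1 hk)
      have h4 : (4 : ℂ) ^ J ≠ 0 := pow_ne_zero _ (by norm_num)
      have : ((4 ^ (J + i) : ℕ) : ℂ) * (t + 2 * Real.pi / 4 ^ J * l : ℝ) * Complex.I =
          ((4 ^ (J + i) : ℕ) : ℂ) * t * Complex.I +
            ((4 ^ i * l : ℤ) : ℂ) * (2 * Real.pi * Complex.I) := by
        push_cast
        rw [pow_add]
        field_simp
      rw [this, Complex.exp_add, Complex.exp_int_mul_two_pi_mul_I, mul_one, sub_self]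
    · simp [lacunaryCoeff, hk4]
  simp only [key]
  refine Finset.analyticAt_fun_sum _ fun k _ => ?_
  have hof : ∀ x : ℝ, AnalyticAt ℝ (fun x : ℝ => (x : ℂ)) x := fun x =>
    Complex.ofRealCLM.analyticAt x
  have hexp : ∀ z : ℂ, AnalyticAt ℝ Complex.exp z := fun z =>
    (Complex.differentiable_exp.analyticAt z).restrictScalars
  have hlin : AnalyticAt ℝ (fun t : ℝ => (k : ℂ) * (t : ℂ) * Complex.I) t :=
    (analyticAt_const.mul (hof t)).mul analyticAt_const
  have hlin' : AnalyticAt ℝ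
      (fun t : ℝ => (k : ℂ) * ((t + 2 * Real.pi / 4 ^ J * l : ℝ) : ℂ) * Complex.I) t := by
    simp only [Complex.ofReal_add]
    exact (analyticAt_const.mul ((hof t).add analyticAt_const)).mul analyticAt_const
  exact (analyticAt_const.mul ((hexp _).comp hlin')).sub (analyticAt_const.mul ((hexp _).comp hlin))

/-- Analyticity is an open condition and the points `2πl/4^J` are dense, so analyticity anywhere
would be transported to `0`. -/
theorem not_analyticAt_lacunary (t₀ : ℝ) :
    ¬ AnalyticAt ℝ (trigSum fun k => (lacunaryCoeff k : ℂ)) t₀ := by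
  intro h
  obtain ⟨ε, hε, hball⟩ := Metric.eventually_nhds_iff_ball.1 h.eventually_analyticAt
  obtain ⟨J, hJ⟩ := pow_unbounded_of_one_lt (2 * Real.pi / ε) (by norm_num : (1 : ℝ) < 4)
  set d : ℝ := 2 * Real.pi / 4 ^ J with hd
  have hd0 : 0 < d := by positivity
  have hdε : d < ε := by
    rw [div_lt_iff₀ hε] at hJ
    rw [hd, div_lt_iff₀ (by positivity)]; linarith
  set l : ℤ := ⌊t₀ / d⌋ with hl
  have h1 : d * l ≤ t₀ := by
    have := Int.floor_le (t₀ / d)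
    rw [le_div_iff₀ hd0] at this; linarith
  have h2 : t₀ < d * l + d := by
    have := Int.lt_floor_add_one (t₀ / d)
    rw [div_lt_iff₀ hd0] at this; linarith
  have h3 : AnalyticAt ℝ (trigSum fun k => (lacunaryCoeff k : ℂ)) (0 + d * l) := by
    refine hball _ ?_
    rw [Metric.mem_ball, Real.dist_eq, abs_lt]
    constructor <;> linarith
  have h4 : AnalyticAt ℝ (fun t => trigSum (fun k => (lacunaryCoeff k : ℂ)) (t + d * l)) 0 :=
    h3.comp (f := fun t : ℝ => t + d * l) (analyticAt_id.add analyticAt_const)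
  refine not_analyticAt_zero_lacunary ?_
  have := h4.sub (analyticAt_trigSum_lacunary_sub J l 0)
  refine this.congr (Filter.Eventually.of_forall fun t => ?_)
  simp [hd]

/-! ### The lacunary series as an element of `A^p(Dⁿ)` -/

/-- The power series `∑ cₖ zᵏ`. -/
def powerSum (c : ℕ → ℂ) (z : ℂ) : ℂ := ∑' k : ℕ, c k * z ^ k

theorem norm_mul_pow_le_of_norm_le_one (c : ℕ → ℂ) (k : ℕ) {z : ℂ} (hz : ‖z‖ ≤ 1) :
    ‖c k * z ^ k‖ ≤ ‖c k‖ := by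
  rw [norm_mul, norm_pow]
  exact mul_le_of_le_one_right (norm_nonneg _) (pow_le_one₀ (norm_nonneg _) hz)

theorem powerSum_exp (c : ℕ → ℂ) (t : ℝ) : powerSum c (Circle.exp t) = trigSum c t := by
  refine tsum_congr fun k => ?_
  rw [Circle.coe_exp, ← Complex.exp_nat_mul, mul_assoc]

theorem RapidlyDecreasing.continuousOn_powerSum {c : ℕ → ℂ} (hc : RapidlyDecreasing c) :
    ContinuousOn (powerSum c) (Metric.closedBall 0 1) :=
  continuousOn_tsum (fun k => by fun_prop) hc.summable_norm fun k z hz =>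
    norm_mul_pow_le_of_norm_le_one c k (mem_closedBall_zero_iff.1 hz)

theorem RapidlyDecreasing.succ_mul_succ {c : ℕ → ℂ} (hc : RapidlyDecreasing c) :
    RapidlyDecreasing fun k => (k + 1 : ℕ) * c (k + 1) := fun m => by
  refine ((summable_nat_add_iff 1).2 (hc (m + 1))).of_nonneg_of_le (fun k => by positivity)
    fun k => ?_
  rw [norm_mul, Complex.norm_natCast, pow_succ, mul_comm _ ‖c (k + 1)‖, mul_assoc,
    mul_comm ((k + 1 : ℕ) : ℝ)]
  gcongr
  exact Nat.le_succ k

theorem RapidlyDecreasing.hasDerivAt_powerSum {c : ℕ → ℂ} (hc : RapidlyDecreasing c) {z : ℂ}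
    (hz : ‖z‖ < 1) :
    HasDerivAt (powerSum c) (powerSum (fun k => (k + 1 : ℕ) * c (k + 1)) z) z := by
  have hterm : ∀ (k : ℕ) (w : ℂ), w ∈ Metric.ball (0 : ℂ) 1 →
      HasDerivAt (fun w : ℂ => c k * w ^ k) (c k * (k * w ^ (k - 1))) w := fun k w _ =>
    (hasDerivAt_pow k w).const_mul (c k)
  have hbound : ∀ (k : ℕ) (w : ℂ), w ∈ Metric.ball (0 : ℂ) 1 →
      ‖c k * (k * w ^ (k - 1))‖ ≤ ‖c k‖ * (k : ℝ) ^ 1 := fun k w hw => by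
    rw [norm_mul, norm_mul, norm_pow, Complex.norm_natCast, pow_one]
    refine mul_le_mul_of_nonneg_left (mul_le_of_le_one_right (Nat.cast_nonneg k)
      (pow_le_one₀ (norm_nonneg _) ?_)) (norm_nonneg _)
    exact (mem_ball_zero_iff.1 hw).le
  have hzmem : z ∈ Metric.ball (0 : ℂ) 1 := mem_ball_zero_iff.2 hz
  have h := hasDerivAt_tsum_of_isPreconnected (hc 1) Metric.isOpen_ball
    (convex_ball (0 : ℂ) 1).isPreconnected hterm hbound hzmem
    (Summable.of_norm_bounded hc.summable_norm fun k =>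
      norm_mul_pow_le_of_norm_le_one c k hz.le) hzmem
  have hs : Summable fun k : ℕ => c k * (k * z ^ (k - 1)) :=
    Summable.of_norm_bounded (hc 1) fun k => hbound k z hzmem
  rw [hs.tsum_eq_zero_add] at h
  simp only [Nat.cast_zero, zero_mul, mul_zero, zero_add, Nat.add_sub_cancel] at h
  convert! h using 1
  refine tsum_congr fun k => ?_
  ring

theorem mapsTo_closedPolydisc {n : ℕ} (i : Fin n) :
    MapsTo (fun z : Fin n → ℂ => z i) (closedPolydisc n) (Metric.closedBall 0 1) :=
  fun _ hz => mem_closedBall_zero_iff.2 (hz i)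

theorem RapidlyDecreasing.continuousOn_powerSum_coord {n : ℕ} {c : ℕ → ℂ}
    (hc : RapidlyDecreasing c) (i : Fin n) :
    ContinuousOn (fun z : Fin n → ℂ => powerSum c (z i)) (closedPolydisc n) :=
  hc.continuousOn_powerSum.comp (by fun_prop) (mapsTo_closedPolydisc i)

/-- Series in `z i₀` with rapidly decreasing coefficients are stable under every partial derivative,
and each is continuous on the closed polydisc. Equality is asked only on the open polydisc so that
`f` may be a zero extension. -/
theorem exists_mixedPartial_powerSum_eqOn {n : ℕ} (i₀ : Fin n) {f : (Fin n → ℂ) → ℂ}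
    {c : ℕ → ℂ} (hc : RapidlyDecreasing c)
    (hf : EqOn f (fun z => powerSum c (z i₀)) (polydisc n)) (α : Fin n → ℕ) :
    ∃ d, RapidlyDecreasing d ∧
      EqOn (mixedPartial α f) (fun z => powerSum d (z i₀)) (polydisc n) := by
  refine mixedPartial_induction (P := fun f _ _ => ∃ d, RapidlyDecreasing d ∧
    EqOn f (fun z => powerSum d (z i₀)) (polydisc n)) ?_ α (g := f) (h := f) ⟨c, hc, hf⟩
  rintro i f - - ⟨d, hd, hfd⟩
  have hline := hfd.lineDeriv_of_isOpen (isOpen_polydisc n) (Pi.single i 1)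
  by_cases hi : i = i₀
  · subst hi
    refine ⟨_, hd.succ_mul_succ, hline.trans fun z hz => HasLineDerivAt.lineDeriv ?_⟩
    have h1 : HasDerivAt (fun t : ℂ => (z + t • (Pi.single i 1 : Fin n → ℂ)) i) 1 0 := by
      simpa using (hasDerivAt_id (0 : ℂ)).const_add (z i)
    have h2 : HasDerivAt (powerSum d) (powerSum (fun k => (k + 1 : ℕ) * d (k + 1)) (z i))
        ((z + (0 : ℂ) • (Pi.single i 1 : Fin n → ℂ)) i) := by
      simpa using hd.hasDerivAt_powerSum (hz i)
    simpa [HasLineDerivAt, Function.comp_def] using h2.comp (0 : ℂ) h1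
  · refine ⟨0, fun m => by simp, hline.trans fun z _ => ?_⟩
    simp [lineDeriv, powerSum, Ne.symm hi]

namespace PolydiscAlgebra

/-- The function `∑ cₖ zᵢᵏ` with `c` rapidly decreasing, as an element of `A^p(Dⁿ)`. -/
def ofCoeffs {n : ℕ} {p : ℕ∞} (i : Fin n) (c : ℕ → ℂ) (hc : RapidlyDecreasing c) :
    PolydiscAlgebra n p where
  toContinuousMap := ⟨fun z => powerSum c (z.1 i), (hc.continuousOn_powerSum_coord i).domRestrict⟩
  holomorphic := by
    have h : DifferentiableOn ℂ (fun z : Fin n → ℂ => powerSum c (z i)) (polydisc n) :=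
      fun z hz => (DifferentiableAt.comp (g := powerSum c) (f := fun z : Fin n → ℂ => z i) z
        (hc.hasDerivAt_powerSum (hz i)).differentiableAt
        (by fun_prop)).differentiableWithinAt
    exact h.congr fun z hz => zeroExtend_apply _ ⟨z, polydisc_subset_closedPolydisc n hz⟩
  partials_extend α _ := by
    obtain ⟨d, hd, h⟩ := exists_mixedPartial_powerSum_eqOn i hc
      (fun z hz => zeroExtend_apply (fun z => powerSum c (z.1 i))
        ⟨z, polydisc_subset_closedPolydisc n hz⟩) α
    exact ⟨_, hd.continuousOn_powerSum_coord i, h⟩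

theorem ofCoeffs_restrictTorus {n : ℕ} {p : ℕ∞} (i : Fin n) {c : ℕ → ℂ}
    (hc : RapidlyDecreasing c) (ζ : Fin n → Circle) :
    (ofCoeffs i c hc : PolydiscAlgebra n p).restrictTorus ζ = powerSum c (ζ i) := rfl

end PolydiscAlgebra

/-! ### Density -/

/-- A function real analytic at some point of the torus is real analytic in one given variable at
some point with rational arguments. -/
theorem TorusRealAnalyticAt.exists_rat_analyticAt {n : ℕ} {F : (Fin n → Circle) → ℂ}
    {ζ : Fin n → Circle} (hF : TorusRealAnalyticAt F ζ) (i₀ : Fin n) :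
    ∃ r : Fin n → ℚ, AnalyticAt ℝ
      (fun t : ℝ => F fun i => Circle.exp (Function.update (fun i => (r i : ℝ)) i₀ t i))
      (r i₀) := by
  obtain ⟨θ, -, a, δ, hδ, hsum, hF⟩ := hF
  have hcorner := hsum (fun i => θ i + δ) ⟨fun i => by dsimp; linarith, fun i => le_rfl⟩
  simp only [add_sub_cancel_left, Finset.prod_pow_eq_pow_sum, norm_mul, norm_pow,
    Complex.norm_real, Real.norm_eq_abs, abs_of_pos hδ] at hcorner
  choose r hr1 hr2 using fun i => exists_rat_btwn (by linarith : θ i - δ < θ i + δ)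
  refine ⟨r, ?_⟩
  -- Only the coordinate `i₀` is made complex; the others are frozen at rational points of the box.
  -- The corner series then dominates on the disc of radius `δ`, so the sum is holomorphic in `w`.
  have hterm : ∀ (k : Fin n → ℕ) (w : ℂ), w ∈ Metric.ball (0 : ℂ) δ →
      ‖a k * ∏ i, Function.update (fun i => ((r i - θ i : ℝ) : ℂ)) i₀ w i ^ k i‖ ≤
        ‖a k‖ * δ ^ ∑ i, k i := by
    intro k w hw
    rw [norm_mul, norm_prod, ← Finset.prod_pow_eq_pow_sum]
    refine mul_le_mul_of_nonneg_left
      (Finset.prod_le_prod (fun _ _ => norm_nonneg _) fun i _ => ?_) (norm_nonneg _)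
    rw [norm_pow]
    refine pow_le_pow_left₀ (norm_nonneg _) ?_ _
    rcases eq_or_ne i i₀ with rfl | hi
    · simpa using (mem_ball_zero_iff.1 hw).le
    · rw [Function.update_of_ne hi, Complex.norm_real, Real.norm_eq_abs, abs_le]
      constructor <;> linarith [hr1 i, hr2 i]
  have hdiff : DifferentiableOn ℂ (fun w : ℂ => ∑' k : Fin n → ℕ,
      a k * ∏ i, Function.update (fun i => ((r i - θ i : ℝ) : ℂ)) i₀ w i ^ k i)
      (Metric.ball 0 δ) := by
    refine Complex.differentiableOn_tsum_of_summable_norm hcorner (fun k => ?_)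
      Metric.isOpen_ball hterm
    refine Differentiable.differentiableOn ?_
    refine Differentiable.const_mul (Differentiable.fun_finsetProd fun i _ => ?_) _
    refine Differentiable.pow ?_ _
    rcases eq_or_ne i i₀ with rfl | hi
    · simp
    · simp [Function.update_of_ne hi]
  have hmem : ((r i₀ - θ i₀ : ℝ) : ℂ) ∈ Metric.ball (0 : ℂ) δ := by
    rw [mem_ball_zero_iff, Complex.norm_real, Real.norm_eq_abs, abs_lt]
    constructor <;> linarith [hr1 i₀, hr2 i₀]
  have han := (hdiff.analyticAt (Metric.isOpen_ball.mem_nhds hmem)).restrictScalars (𝕜 := ℝ)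
  have hof : AnalyticAt ℝ (fun t : ℝ => ((t - θ i₀ : ℝ) : ℂ)) (r i₀) :=
    (Complex.ofRealCLM.analyticAt _).comp (f := fun t : ℝ => t - θ i₀)
      (analyticAt_id.sub analyticAt_const)
  refine (AnalyticAt.comp (f := fun t : ℝ => ((t - θ i₀ : ℝ) : ℂ)) han hof).congr ?_
  filter_upwards [Ioo_mem_nhds (hr1 i₀) (hr2 i₀)] with t ht
  have hbox : Function.update (fun i => (r i : ℝ)) i₀ t ∈
      Icc (fun i => θ i - δ) (fun i => θ i + δ) := by
    refine ⟨fun i => ?_, fun i => ?_⟩ <;> rcases eq_or_ne i i₀ with rfl | hi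
    · simpa using ht.1.le
    · simpa [Function.update_of_ne hi] using (hr1 i).le
    · simpa using ht.2.le
    · simpa [Function.update_of_ne hi] using (hr2 i).le
  rw [← (hF.hasSum hbox).tsum_eq]
  refine tsum_congr fun k => ?_
  congr 1
  refine Finset.prod_congr rfl fun i _ => ?_
  rcases eq_or_ne i i₀ with rfl | hi
  · simp
  · simp [Function.update_of_ne hi]

namespace PolydiscAlgebra

variable {n : ℕ} {p : ℕ∞}

/-- For a fixed `f`, only countably many real multiples of the lacunary series can be added to `f`
so that the sum is real analytic somewhere on the torus. -/
theorem countable_setOf_torusRealAnalyticAt (f : PolydiscAlgebra n p) (i₀ : Fin n) :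
    {c : ℝ | ∃ ζ, TorusRealAnalyticAt (f.addConstMul
      (ofCoeffs i₀ _ rapidlyDecreasing_lacunaryCoeff) c).restrictTorus ζ}.Countable := by
  have h : ∀ c ∈ {c : ℝ | ∃ ζ, TorusRealAnalyticAt (f.addConstMul
      (ofCoeffs i₀ _ rapidlyDecreasing_lacunaryCoeff) c).restrictTorus ζ},
      ∃ r : Fin n → ℚ, AnalyticAt ℝ (fun t : ℝ =>
        f.restrictTorus (fun i => Circle.exp (Function.update (fun i => (r i : ℝ)) i₀ t i)) +
          c * trigSum (fun k => (lacunaryCoeff k : ℂ)) t) (r i₀) := by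
    rintro c ⟨ζ, hζ⟩
    obtain ⟨r, hr⟩ := hζ.exists_rat_analyticAt i₀
    refine ⟨r, hr.congr (Filter.Eventually.of_forall fun t => ?_)⟩
    simp only [addConstMul_restrictTorus, ofCoeffs_restrictTorus, Function.update_self,
      powerSum_exp]
  choose! r hr using h
  -- If `c ≠ d` had the same rational point, subtracting would cancel `f`, and dividing by `c - d`
  -- would make the lacunary series analytic there.
  refine (mapsTo_univ r _).countable_of_injOn (fun c hc d hd hcd => ?_) countable_univ
  by_contra hne
  have h1 := hr c hc
  rw [hcd] at h1
  have h2 := (analyticAt_const (v := ((c - d : ℝ) : ℂ)⁻¹)).mul (h1.sub (hr d hd))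
  refine not_analyticAt_lacunary _ (h2.congr (Filter.Eventually.of_forall fun t => ?_))
  have hne' : ((c - d : ℝ) : ℂ) ≠ 0 := Complex.ofReal_ne_zero.2 (sub_ne_zero.2 hne)
  simp only [Pi.mul_apply, Pi.sub_apply, add_sub_add_left_eq_sub, ← sub_mul, ← Complex.ofReal_sub]
  rw [inv_mul_cancel_left₀ hne']

theorem dense_setOf_not_torusRealAnalyticAt (hn : 1 ≤ n) :
    Dense {f : PolydiscAlgebra n p | ∀ ζ, ¬ TorusRealAnalyticAt f.restrictTorus ζ} := by
  intro f
  -- Any coordinate would do; `1 ≤ n` provides one.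
  let i₀ : Fin n := ⟨0, hn⟩
  have hdense := (countable_setOf_torusRealAnalyticAt f i₀).dense_compl ℝ
  rw [mem_closure_iff_nhds]
  intro U hU
  have hpre := (tendsto_addConstMul f
    (ofCoeffs i₀ _ rapidlyDecreasing_lacunaryCoeff)).eventually hU
  obtain ⟨c, hcU, hc⟩ := mem_closure_iff_nhds.1 (hdense 0) _ hpre
  exact ⟨_, hcU, fun ζ hζ => hc ⟨ζ, hζ⟩⟩

end PolydiscAlgebra

end

theorem mainTheorem6 (n : ℕ) (hn : 1 ≤ n) (p : ℕ∞) :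
    (∀ ζ : Fin n → Circle,
      IsGδ {f : PolydiscAlgebra n p | ¬ TorusRealAnalyticAt f.restrictTorus ζ} ∧
      Dense {f : PolydiscAlgebra n p | ¬ TorusRealAnalyticAt f.restrictTorus ζ}) ∧
    (IsGδ {f : PolydiscAlgebra n p |
        ∀ ζ : Fin n → Circle, ¬ TorusRealAnalyticAt f.restrictTorus ζ} ∧
      Dense {f : PolydiscAlgebra n p |
        ∀ ζ : Fin n → Circle, ¬ TorusRealAnalyticAt f.restrictTorus ζ}) := by
  have hdense := PolydiscAlgebra.dense_setOf_not_torusRealAnalyticAt (p := p) hn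
  refine ⟨fun ζ => ⟨?_, hdense.mono (ofPred_subset_ofPred.2 fun f hf => hf ζ)⟩, ?_, hdense⟩
  · simpa using PolydiscAlgebra.isGδ_setOf_not_torusRealAnalyticAt (p := p)
      (isClosed_singleton (x := ζ))
  · simpa using PolydiscAlgebra.isGδ_setOf_not_torusRealAnalyticAt (n := n) (p := p) isClosed_univ
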